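/- An L-presentation (finite endomorphic presentation) is a quadruple $\langle S \mid R_1 \mid \Phi \mid R_2\rangle$, where $S$ is a finite set, $R_1$ and $R_2$ are finite subsets of the free group $\mathcal F_S$ on $S$, and $\Phi$ is a finite set of endomorphisms of $\mathcal F_S$. It defines the group $$\big\langle S \;\big|\; R_1\cup\{\sigma(r) : r\in R_2,\ \sigma\in\Phi^*\}\big\rangle,$$ where $\Phi^*$ is the submonoid of $\operatorname{End}(\mathcal F_S)$ generated by $\Phi$ (it contains the identity). A group is called L-presented if it is isomorphic to a group defined by an L-presentation. A finitely generated group $G$ has computable finite quotients (CFQ) with respect to a finite generating family $s_1,\dots,s_k$ if there is an algorithm which, given a finite presentation of a finite group $F$ and words in the generators of this presentation representing elements $f(s_1),\dots,f(s_k)\in F$, always terminates and determines whether there exists a group homomorphism $\hat f\colon G\to F$ with $\hat f(s_i)=f(s_i)$ for all $i=1,\dots,k$. (The input presentation is promised to define a finite group; nothing is required of the algorithm on other inputs.) Proposition. Every L-presented group is finitely generated and has computable finite quotients with respect to each of its finite generating families. -/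

import Mathlib

/-! ### L-presented groups -/

/-- An L-presentation (finite endomorphic presentation) `⟨S | R₁ | Φ | R₂⟩` on the set of generating
symbols `S` (which is required to be finite in `IsLPresented`): two finite sets `R₁`, `R₂` of
elements of the free group on `S` and a finite set `Φ` of endomorphisms of that free group. -/
structure LPresentation (S : Type) where
  fixedRels : Finset (FreeGroup S)
  endos : Finset (Monoid.End (FreeGroup S))
  iteratedRels : Finset (FreeGroup S)

namespace LPresentation

variable {S : Type}

/-- The relators of the ordinary presentation defined by an L-presentation: `R₁`, together with the
images of the elements of `R₂` under all finite compositions (the empty one included) of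
endomorphisms in `Φ`. -/
def relators (L : LPresentation S) : Set (FreeGroup S) :=
  (L.fixedRels : Set (FreeGroup S)) ∪
    {w | ∃ σ ∈ Submonoid.closure (L.endos : Set (Monoid.End (FreeGroup S))),
      ∃ r ∈ L.iteratedRels, w = σ r}

/-- The group defined by an L-presentation. -/
abbrev group (L : LPresentation S) : Type := PresentedGroup L.relators

end LPresentation

/-- A group is L-presented if it is isomorphic to the group defined by some L-presentation on a
finite set of generating symbols. -/
def IsLPresented (G : Type*) [Group G] : Prop :=
  ∃ (S : Type) (_ : Finite S) (L : LPresentation S), Nonempty (G ≃* L.group)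

/-! ### Finite presentations as inputs of algorithms -/

/-- Words in the letters `x₀, x₁, …` and their inverses: `(i, true)` stands for `xᵢ` and
`(i, false)` for its inverse. -/
abbrev GroupWord : Type := List (ℕ × Bool)

/-- The code `(n, [r₁, …, rₘ])` of the finite presentation `⟨x₀, …, xₙ₋₁ | r₁, …, rₘ⟩`. -/
abbrev FinPresCode : Type := ℕ × List GroupWord

/-- The element of the free group on `x₀, …, xₙ₋₁` spelled by a word. Letters with index at least
`n`, which do not occur in well-formed codes, are read as the identity. -/
def GroupWord.toFreeGroup (n : ℕ) (w : GroupWord) : FreeGroup (Fin n) :=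
  FreeGroup.lift (fun i : ℕ => if h : i < n then FreeGroup.of (⟨i, h⟩ : Fin n) else 1)
    (FreeGroup.mk w)

namespace FinPresCode

/-- The relators of the coded presentation. -/
def relators (P : FinPresCode) : Set (FreeGroup (Fin P.1)) :=
  {r | ∃ w ∈ P.2, r = GroupWord.toFreeGroup P.1 w}

/-- The group defined by the coded presentation. -/
abbrev group (P : FinPresCode) : Type := PresentedGroup (relators P)

/-- The element of the group defined by the coded presentation that a word represents. -/
def elem (P : FinPresCode) (w : GroupWord) : group P :=
  PresentedGroup.mk (relators P) (GroupWord.toFreeGroup P.1 w)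

end FinPresCode

/-! ### Computable finite quotients -/

/-- `G` has computable finite quotients with respect to the family `s = (s₀, …, sₖ₋₁)`: there is an
algorithm (a partial recursive function) which, given a finite presentation of a finite group `F`
and words representing the values `f s₀, …, f sₖ₋₁ ∈ F`, halts and decides whether there is a
homomorphism `φ : G →* F` with `φ sᵢ = f sᵢ` for all `i`. Nothing is required of the algorithm when
the group given by the presentation is infinite. -/
def HasCFQWith {G : Type*} [Group G] {k : ℕ} (s : Fin k → G) : Prop :=
  ∃ A : FinPresCode × (Fin k → GroupWord) →. Bool, Partrec A ∧
    ∀ (P : FinPresCode) (f : Fin k → GroupWord), Finite (FinPresCode.group P) →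
      ∃ b ∈ A (P, f), (b = true ↔
        ∃ φ : G →* FinPresCode.group P, ∀ i, φ (s i) = FinPresCode.elem P (f i))

/-- A group has computable finite quotients (CFQ) if it is finitely generated and has computable
finite quotients with respect to each of its finite generating families. -/
def HasCFQ (G : Type*) [Group G] : Prop :=
  Group.FG G ∧
    ∀ (k : ℕ) (s : Fin k → G), Subgroup.closure (Set.range s) = ⊤ → HasCFQWith s

/-! Let h₀ : F_S → F be the homomorphism that the prescribed values induce once the generators in S
are written as words in the family. The values extend to G exactly when h₀ kills R₁, when each
member of the family, rewritten through S, gets its own value back, and when h₀ ∘ σ kills R₂ for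
every σ in Φ* (`LPresentation.exists_hom_iff`). Only the last condition is infinite. As S and F are
finite, there are finitely many homomorphisms F_S → F, so the orbit of h₀ under precomposition with
Φ* is finite. A positive answer is thus certified by a finite set of homomorphisms that contains h₀,
is closed under precomposition with Φ and kills R₂ (`LPresentation.accepts_iff`); a negative one by
a single relator with nontrivial image (`LPresentation.rejects_iff`).

Both certificates can be searched for. Triviality of a word is witnessed by a product of conjugates
of relators (`FinPresCode.semiDec_elem_eq_one`), nontriviality in a finite group by a permutation
action that moves a point (`FinPresCode.separated_iff`). Running the two searches in parallel
decides the question. -/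

/-! ### Semidecidable predicates -/

/-- A predicate is semidecidable if it says that there is a natural number passing a primitive
recursive test. -/
def SemiDec {α : Type*} [Primcodable α] (p : α → Prop) : Prop :=
  ∃ q : α × ℕ → Prop, PrimrecPred q ∧ ∀ a, p a ↔ ∃ n, q (a, n)

theorem PrimrecRel.mem_list {α : Type*} [Primcodable α] :
    PrimrecRel fun (L : List α) (a : α) => a ∈ L :=
  (PrimrecRel.exists_mem_list (R := fun a b : α => a = b) Primrec.eq).of_eq fun L a => by simp

theorem PrimrecPred.exists_mem {α β : Type*} [Primcodable α] [Primcodable β] {l : α → List β}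
    (hl : Primrec l) {p : α → β → Prop} (hp : PrimrecPred fun x : α × β => p x.1 x.2) :
    PrimrecPred fun a => ∃ b ∈ l a, p a b := by
  have h : PrimrecRel fun (b : β) (a : α) => p a b := hp.comp (Primrec.snd.pair Primrec.fst)
  exact h.exists_mem_list.comp hl Primrec.id

theorem PrimrecPred.forall_mem {α β : Type*} [Primcodable α] [Primcodable β] {l : α → List β}
    (hl : Primrec l) {p : α → β → Prop} (hp : PrimrecPred fun x : α × β => p x.1 x.2) :
    PrimrecPred fun a => ∀ b ∈ l a, p a b := by
  have h : PrimrecRel fun (b : β) (a : α) => p a b := hp.comp (Primrec.snd.pair Primrec.fst)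
  exact h.forall_mem_list.comp hl Primrec.id

namespace SemiDec

variable {α β : Type*} [Primcodable α] [Primcodable β]

theorem of_eq {p q : α → Prop} (hp : SemiDec p) (h : ∀ a, p a ↔ q a) : SemiDec q := by
  obtain ⟨r, hr, H⟩ := hp
  exact ⟨r, hr, fun a => (h a).symm.trans (H a)⟩

theorem of_primrecPred {p : α → Prop} (hp : PrimrecPred p) : SemiDec p :=
  ⟨fun x => p x.1, hp.comp Primrec.fst, fun _ => ⟨fun h => ⟨0, h⟩, fun ⟨_, h⟩ => h⟩⟩

theorem comp {p : β → Prop} (hp : SemiDec p) {f : α → β} (hf : Primrec f) :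
    SemiDec fun a => p (f a) := by
  obtain ⟨r, hr, H⟩ := hp
  exact ⟨fun x => r (f x.1, x.2), hr.comp ((hf.comp Primrec.fst).pair Primrec.snd),
    fun a => H (f a)⟩

theorem exists_primrecPred {p : α → β → Prop} (hp : PrimrecPred fun x : α × β => p x.1 x.2) :
    SemiDec fun a => ∃ b, p a b := by
  refine ⟨fun x => ∃ b ∈ (Encodable.decode (α := β) x.2).toList, p x.1 b, ?_, fun a => ?_⟩
  · exact PrimrecPred.exists_mem (Primrec.optionToList.comp (Primrec.decode.comp Primrec.snd))
      (hp.comp ((Primrec.fst.comp Primrec.fst).pair Primrec.snd))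
  · constructor
    · rintro ⟨b, hb⟩
      exact ⟨Encodable.encode b, b, by simp, hb⟩
    · rintro ⟨_, b, _, hb⟩
      exact ⟨b, hb⟩

theorem exists_ {p : α → β → Prop} (hp : SemiDec fun x : α × β => p x.1 x.2) :
    SemiDec fun a => ∃ b, p a b := by
  obtain ⟨r, hr, H⟩ := hp
  have : SemiDec fun a : α => ∃ c : β × ℕ, r ((a, c.1), c.2) :=
    exists_primrecPred (hr.comp ((Primrec.fst.pair (Primrec.fst.comp Primrec.snd)).pair
      (Primrec.snd.comp Primrec.snd)))
  refine this.of_eq fun a => ?_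
  simp only [Prod.exists]
  exact exists_congr fun b => (H (a, b)).symm

theorem and {p q : α → Prop} (hp : SemiDec p) (hq : SemiDec q) : SemiDec fun a => p a ∧ q a := by
  obtain ⟨r, hr, H⟩ := hp
  obtain ⟨s, hs, K⟩ := hq
  have : SemiDec fun a : α => ∃ c : ℕ × ℕ, r (a, c.1) ∧ s (a, c.2) :=
    exists_primrecPred ((hr.comp (Primrec.fst.pair (Primrec.fst.comp Primrec.snd))).and
      (hs.comp (Primrec.fst.pair (Primrec.snd.comp Primrec.snd))))
  refine this.of_eq fun a => ?_
  simp only [Prod.exists, exists_and_left, exists_and_right, H, K]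

theorem or {p q : α → Prop} (hp : SemiDec p) (hq : SemiDec q) : SemiDec fun a => p a ∨ q a := by
  obtain ⟨r, hr, H⟩ := hp
  obtain ⟨s, hs, K⟩ := hq
  refine ⟨fun x => r x ∨ s x, hr.or hs, fun a => ?_⟩
  simp only [exists_or, H, K]

theorem exists_mem {p : α → β → Prop} {l : α → List β} (hl : Primrec l)
    (hp : SemiDec fun x : α × β => p x.1 x.2) : SemiDec fun a => ∃ b ∈ l a, p a b :=
  exists_ ((of_primrecPred (PrimrecRel.mem_list.comp (hl.comp Primrec.fst) Primrec.snd)).and hp)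

theorem forall_mem {p : α → β → Prop} {l : α → List β} (hl : Primrec l)
    (hp : SemiDec fun x : α × β => p x.1 x.2) : SemiDec fun a => ∀ b ∈ l a, p a b := by
  obtain ⟨r, hr, H⟩ := hp
  refine ⟨fun x => ∀ b ∈ l x.1, ∃ n < x.2, r ((x.1, b), n), ?_, fun a => ?_⟩
  · refine PrimrecPred.forall_mem (hl.comp Primrec.fst) ?_
    refine (PrimrecPred.exists_mem (Primrec.list_range.comp (Primrec.snd.comp Primrec.fst))
      (p := fun (y : (α × ℕ) × β) n => r ((y.1.1, y.2), n)) ?_).of_eq fun y => by simp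
    have h := Primrec.fst (α := (α × ℕ) × β) (β := ℕ)
    exact hr.comp (((Primrec.fst.comp (Primrec.fst.comp h)).pair (Primrec.snd.comp h)).pair
      Primrec.snd)
  · constructor
    · intro h
      have h' : ∀ b, ∃ n, b ∈ l a → r ((a, b), n) := fun b => by
        by_cases hb : b ∈ l a
        · exact ((H (a, b)).1 (h b hb)).imp fun n hn _ => hn
        · exact ⟨0, fun h => absurd h hb⟩
      choose g hg using h'
      -- The sum dominates every individual witness; the `+ 1` makes the bound strict.
      refine ⟨((l a).map g).sum + 1, fun b hb => ⟨g b, ?_, hg b hb⟩⟩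
      exact Nat.lt_succ_of_le (List.le_sum_of_mem (List.mem_map_of_mem hb))
    · rintro ⟨N, hN⟩ b hb
      obtain ⟨n, _, hn⟩ := hN b hb
      exact (H (a, b)).2 ⟨n, hn⟩

end SemiDec

/-- Two semidecidable predicates can be run in parallel: the resulting algorithm is correct on every
input on which they are complementary. -/
theorem SemiDec.exists_partrec_decides {α : Type*} [Primcodable α] {p q : α → Prop}
    (hp : SemiDec p) (hq : SemiDec q) :
    ∃ A : α →. Bool, Partrec A ∧ ∀ a, (q a ↔ ¬ p a) → ∃ b ∈ A a, (b = true ↔ p a) := by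
  obtain ⟨r, ⟨_, hr⟩, H⟩ := hp
  obtain ⟨s, ⟨_, hs⟩, K⟩ := hq
  -- Stage `n` of the parallel search. The test for `p` has priority, which is harmless: on the
  -- inputs that matter the two predicates exclude each other.
  let f : α → ℕ → Option Bool := fun a n =>
    bif decide (r (a, n)) then some true else bif decide (s (a, n)) then some false else none
  have hf : Primrec₂ f := Primrec.cond hr (Primrec.const _)
    (Primrec.cond hs (Primrec.const _) (Primrec.const _))
  have hr' : ∀ a n, r (a, n) → f a n = some true := fun a n h => by simp [f, h]
  have hs' : ∀ a n, s (a, n) → ¬ r (a, n) → f a n = some false := fun a n h h' => by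
    simp [f, h, h']
  refine ⟨fun a => Nat.rfindOpt (f a), Partrec.rfindOpt hf.to_comp, fun a ha => ?_⟩
  have hdom : (Nat.rfindOpt (f a)).Dom := by
    rw [Nat.rfindOpt_dom]
    by_cases h : p a
    · obtain ⟨n, hn⟩ := (H a).1 h
      exact ⟨n, true, hr' a n hn⟩
    · obtain ⟨n, hn⟩ := (K a).1 (ha.2 h)
      exact ⟨n, false, hs' a n hn fun h' => h ((H a).2 ⟨n, h'⟩)⟩
  obtain ⟨b, hb⟩ := Part.dom_iff_mem.1 hdom
  refine ⟨b, hb, ?_⟩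
  obtain ⟨n, hn⟩ := Nat.rfindOpt_spec hb
  by_cases h₁ : r (a, n)
  · have : b = true := by simpa [hr' a n h₁, eq_comm] using hn
    simp [this, (H a).2 ⟨n, h₁⟩]
  · by_cases h₂ : s (a, n)
    · have : b = false := by simpa [hs' a n h₂ h₁, eq_comm] using hn
      simp [this, ha.1 ((K a).2 ⟨n, h₂⟩)]
    · simp [f, h₁, h₂] at hn

/-! ### Words -/

theorem FreeGroup.primrec_reduce {α : Type*} [Primcodable α] [DecidableEq α] :
    Primrec (FreeGroup.reduce : List (α × Bool) → List (α × Bool)) := by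
  -- Reduction is the right fold of this step, which cancels a letter against the head of the
  -- already reduced tail.
  let step : (α × Bool) × List (α × Bool) → List (α × Bool) := fun x =>
    List.casesOn x.2 [x.1] fun hd tl =>
      if x.1.1 = hd.1 ∧ x.1.2 = !hd.2 then tl else x.1 :: hd :: tl
  have hstep : Primrec step := by
    refine Primrec.list_casesOn (f := fun x : (α × Bool) × List (α × Bool) => x.2)
      (g := fun x => [x.1])
      (h := fun x y => if x.1.1 = y.1.1 ∧ x.1.2 = !y.1.2 then y.2 else x.1 :: y.1 :: y.2)
      Primrec.snd (Primrec.list_cons.comp Primrec.fst (Primrec.const [])) ?_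
    have hx := Primrec.fst.comp (Primrec.fst (α := (α × Bool) × List (α × Bool))
      (β := (α × Bool) × List (α × Bool)))
    have hhd := Primrec.fst.comp (Primrec.snd (α := (α × Bool) × List (α × Bool))
      (β := (α × Bool) × List (α × Bool)))
    have htl := Primrec.snd.comp (Primrec.snd (α := (α × Bool) × List (α × Bool))
      (β := (α × Bool) × List (α × Bool)))
    exact Primrec.ite
      ((Primrec.eq.comp (Primrec.fst.comp hx) (Primrec.fst.comp hhd)).and
        (Primrec.eq.comp (Primrec.snd.comp hx) (Primrec.not.comp (Primrec.snd.comp hhd))))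
      htl (Primrec.list_cons.comp hx (Primrec.list_cons.comp hhd htl))
  refine (Primrec.list_foldr Primrec.id (Primrec.const [])
    (hstep.comp Primrec.snd).to₂).of_eq fun L => ?_
  induction L with
  | nil => rfl
  | cons x L ih =>
    rw [FreeGroup.reduce.cons, ← ih]
    rfl

theorem FreeGroup.primrec_invRev {α : Type*} [Primcodable α] :
    Primrec (FreeGroup.invRev : List (α × Bool) → List (α × Bool)) :=
  Primrec.list_reverse.comp (Primrec.list_map Primrec.id
    ((Primrec.fst.comp Primrec.snd).pair (Primrec.not.comp (Primrec.snd.comp Primrec.snd))).to₂)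

namespace GroupWord

/-- The value of a word when the letters are evaluated in a group. -/
def eval {H : Type*} [Group H] (ρ : ℕ → H) (w : GroupWord) : H :=
  FreeGroup.lift ρ (FreeGroup.mk w)

section eval

variable {H : Type*} [Group H] (ρ : ℕ → H)

@[simp]
theorem eval_nil : eval ρ [] = 1 := rfl

theorem eval_append (v w : GroupWord) : eval ρ (v ++ w) = eval ρ v * eval ρ w := by
  rw [eval, ← FreeGroup.mul_mk, map_mul]; rfl

theorem eval_invRev (w : GroupWord) : eval ρ (FreeGroup.invRev w) = (eval ρ w)⁻¹ := by
  rw [eval, ← FreeGroup.inv_mk, map_inv]; rfl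

theorem eval_singleton (i : ℕ) (b : Bool) : eval ρ [(i, b)] = if b then ρ i else (ρ i)⁻¹ := by
  cases b <;> simp [eval]

theorem eval_cons (x : ℕ × Bool) (w : GroupWord) :
    eval ρ (x :: w) = (if x.2 then ρ x.1 else (ρ x.1)⁻¹) * eval ρ w := by
  rw [← eval_singleton, ← eval_append]; rfl

theorem eval_toWord (x : FreeGroup ℕ) : eval ρ x.toWord = FreeGroup.lift ρ x := by
  rw [eval, FreeGroup.mk_toWord]

theorem eval_comp {K : Type*} [Group K] (g : H →* K) (w : GroupWord) :
    eval (fun i => g (ρ i)) w = g (eval ρ w) := by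
  rw [eval, eval, ← MonoidHom.comp_apply]
  congr 1
  ext i
  simp

end eval

/-- Substitution of words for letters; the words are listed in a tuple, and letters beyond its end
are deleted. -/
def subst (t : List GroupWord) (w : GroupWord) : GroupWord :=
  w.flatMap fun x => bif x.2 then t.getD x.1 [] else FreeGroup.invRev (t.getD x.1 [])

theorem eval_subst {H : Type*} [Group H] (ρ : ℕ → H) (t : List GroupWord) (w : GroupWord) :
    eval ρ (subst t w) = eval (fun i => eval ρ (t.getD i [])) w := by
  induction w with
  | nil => rfl
  | cons x w ih =>
    rw [eval_cons, ← ih, subst, List.flatMap_cons, eval_append]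
    congr 1
    obtain ⟨i, b⟩ := x
    cases b
    · exact eval_invRev _ _
    · rfl

theorem primrec_subst : Primrec₂ subst := by
  have h : Primrec fun y : (List GroupWord × GroupWord) × (ℕ × Bool) =>
      y.1.1.getD y.2.1 [] :=
    (Primrec.list_getD []).comp (Primrec.fst.comp Primrec.fst) (Primrec.fst.comp Primrec.snd)
  exact Primrec.list_flatMap Primrec.snd
    (Primrec.cond (Primrec.snd.comp Primrec.snd) h (FreeGroup.primrec_invRev.comp h)).to₂

theorem toFreeGroup_eq_eval (n : ℕ) (w : GroupWord) : toFreeGroup n w =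
    eval (fun i : ℕ => if h : i < n then FreeGroup.of (⟨i, h⟩ : Fin n) else 1) w := rfl

/-- The rank `n` is part of the input, so `FreeGroup (Fin n)` varies with it. Embedding it into the
free group on ℕ lets equality be tested by comparing reduced words over one fixed alphabet. -/
theorem map_val_toFreeGroup (n : ℕ) (w : GroupWord) :
    FreeGroup.map Fin.val (toFreeGroup n w) = FreeGroup.mk (w.filter fun x => x.1 < n) := by
  rw [toFreeGroup_eq_eval, ← eval_comp]
  induction w with
  | nil => rfl
  | cons x w ih =>
    rw [eval_cons, ih]
    obtain ⟨i, b⟩ := x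
    by_cases h : i < n
    · rw [List.filter_cons_of_pos (by simpa using h), ← List.singleton_append,
        ← FreeGroup.mul_mk]
      cases b <;> simp [h, FreeGroup.of, FreeGroup.invRev]
    · rw [List.filter_cons_of_neg (by simpa using h)]
      simp [h]

theorem toFreeGroup_eq_iff {n : ℕ} {v w : GroupWord} : toFreeGroup n v = toFreeGroup n w ↔
    FreeGroup.reduce (v.filter fun x => x.1 < n) =
      FreeGroup.reduce (w.filter fun x => x.1 < n) := by
  rw [← (FreeGroup.map_injective (f := (Fin.val : Fin n → ℕ)) Fin.val_injective).eq_iff,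
    map_val_toFreeGroup, map_val_toFreeGroup]
  exact ⟨FreeGroup.reduce.sound, FreeGroup.reduce.exact⟩

theorem primrecPred_toFreeGroup_eq {α : Type*} [Primcodable α] {n : α → ℕ} {v w : α → GroupWord}
    (hn : Primrec n) (hv : Primrec v) (hw : Primrec w) :
    PrimrecPred fun a => toFreeGroup (n a) (v a) = toFreeGroup (n a) (w a) := by
  have hfilter : Primrec₂ fun (w : GroupWord) (n : ℕ) => w.filter fun x => x.1 < n :=
    PrimrecRel.listFilter (R := fun (x : ℕ × Bool) n => x.1 < n)
      (Primrec.nat_lt.comp (Primrec.fst.comp Primrec.fst) Primrec.snd)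
  exact (Primrec.eq.comp (FreeGroup.primrec_reduce.comp (hfilter.comp hv hn))
    (FreeGroup.primrec_reduce.comp (hfilter.comp hw hn))).of_eq fun _ => toFreeGroup_eq_iff.symm

theorem toFreeGroup_surjective (n : ℕ) : Function.Surjective (toFreeGroup n) := fun x => by
  refine ⟨(FreeGroup.map Fin.val x).toWord, ?_⟩
  rw [toFreeGroup_eq_eval, eval_toWord, ← MonoidHom.comp_apply]
  conv_rhs => rw [← MonoidHom.id_apply _ x]
  congr 1
  ext i
  simp

/-- The product of the conjugates `c r c⁻¹` (or `c r⁻¹ c⁻¹`, according to a sign) given by a list of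
triples `(c, r, ±)`. -/
def conjProd (l : List (GroupWord × GroupWord × Bool)) : GroupWord :=
  l.flatMap fun e => e.1 ++ ((bif e.2.2 then e.2.1 else FreeGroup.invRev e.2.1) ++
    FreeGroup.invRev e.1)

theorem conjProd_append (l m : List (GroupWord × GroupWord × Bool)) :
    conjProd (l ++ m) = conjProd l ++ conjProd m :=
  List.flatMap_append

theorem primrec_conjProd : Primrec conjProd := by
  have h := Primrec.snd (α := List (GroupWord × GroupWord × Bool))
    (β := GroupWord × GroupWord × Bool)
  have hr := Primrec.fst.comp (Primrec.snd.comp h)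
  exact Primrec.list_flatMap Primrec.id (Primrec.list_append.comp (Primrec.fst.comp h)
    (Primrec.list_append.comp (Primrec.cond (Primrec.snd.comp (Primrec.snd.comp h)) hr
      (FreeGroup.primrec_invRev.comp hr)) (FreeGroup.primrec_invRev.comp (Primrec.fst.comp h)))).to₂

end GroupWord

/-! ### Semideciding triviality of words in a coded group. -/

namespace FinPresCode

open GroupWord

/-- The generators of the coded group; those with index too large are trivial. -/
def gen (P : FinPresCode) (i : ℕ) : group P :=
  PresentedGroup.mk (relators P) (if h : i < P.1 then FreeGroup.of (⟨i, h⟩ : Fin P.1) else 1)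

theorem elem_eq_eval (P : FinPresCode) (w : GroupWord) : elem P w = eval P.gen w := by
  rw [elem, toFreeGroup_eq_eval, ← eval_comp]; rfl

theorem elem_surjective (P : FinPresCode) : Function.Surjective (elem P) :=
  (PresentedGroup.mk_surjective _).comp (toFreeGroup_surjective _)

theorem elem_append (P : FinPresCode) (v w : GroupWord) :
    elem P (v ++ w) = elem P v * elem P w := by
  simp only [elem_eq_eval, eval_append]

theorem elem_invRev (P : FinPresCode) (w : GroupWord) :
    elem P (FreeGroup.invRev w) = (elem P w)⁻¹ := by
  simp only [elem_eq_eval, eval_invRev]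

theorem toFreeGroup_append (n : ℕ) (v w : GroupWord) :
    toFreeGroup n (v ++ w) = toFreeGroup n v * toFreeGroup n w := by
  simp only [toFreeGroup_eq_eval, eval_append]

theorem toFreeGroup_invRev (n : ℕ) (w : GroupWord) :
    toFreeGroup n (FreeGroup.invRev w) = (toFreeGroup n w)⁻¹ := by
  simp only [toFreeGroup_eq_eval, eval_invRev]

/-- Inverting a product reverses it, and (c r c⁻¹)⁻¹ = c r⁻¹ c⁻¹ only flips the sign. -/
theorem toFreeGroup_conjProd_inv (n : ℕ) (l : List (GroupWord × GroupWord × Bool)) :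
    toFreeGroup n (conjProd (l.map fun e => (e.1, e.2.1, !e.2.2)).reverse) =
      (toFreeGroup n (conjProd l))⁻¹ := by
  induction l with
  | nil => rfl
  | cons e l ih =>
    rw [List.map_cons, List.reverse_cons, conjProd_append, toFreeGroup_append, ih,
      ← List.singleton_append (l := l), conjProd_append, toFreeGroup_append, mul_inv_rev]
    congr 1
    obtain ⟨c, r, b⟩ := e
    cases b <;> simp [conjProd, toFreeGroup_append, toFreeGroup_invRev, mul_assoc]

theorem mem_normalClosure_relators_iff (P : FinPresCode) (x : FreeGroup (Fin P.1)) :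
    x ∈ Subgroup.normalClosure (relators P) ↔
      ∃ l : List (GroupWord × GroupWord × Bool), (∀ e ∈ l, e.2.1 ∈ P.2) ∧
        x = toFreeGroup P.1 (conjProd l) := by
  constructor
  · intro hx
    -- The normal closure is by definition the subgroup generated by all conjugates of relators, so
    -- ordinary subgroup induction applies.
    induction hx using Subgroup.closure_induction with
    | mem x hx =>
      obtain ⟨r, ⟨w, hw, rfl⟩, hr⟩ := Group.mem_conjugatesOfSet_iff.1 hx
      obtain ⟨c, rfl⟩ := isConj_iff.1 hr
      obtain ⟨c, rfl⟩ := toFreeGroup_surjective P.1 c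
      refine ⟨[(c, w, true)], by simpa using hw, ?_⟩
      simp [conjProd, toFreeGroup_append, toFreeGroup_invRev, mul_assoc]
    | one => exact ⟨[], by simp, rfl⟩
    | mul x y _ _ hx hy =>
      obtain ⟨l, hl, rfl⟩ := hx
      obtain ⟨m, hm, rfl⟩ := hy
      refine ⟨l ++ m, fun e he => (List.mem_append.1 he).elim (hl e) (hm e), ?_⟩
      rw [conjProd_append, toFreeGroup_append]
    | inv x _ hx =>
      obtain ⟨l, hl, rfl⟩ := hx
      refine ⟨(l.map fun e => (e.1, e.2.1, !e.2.2)).reverse, fun e he => ?_, ?_⟩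
      · obtain ⟨a, ha, rfl⟩ := List.mem_map.1 (List.mem_reverse.1 he)
        exact hl a ha
      · exact (toFreeGroup_conjProd_inv P.1 l).symm
  · rintro ⟨l, hl, rfl⟩
    induction l with
    | nil => exact one_mem _
    | cons e l ih =>
      rw [conjProd, List.flatMap_cons, toFreeGroup_append]
      refine mul_mem ?_ (ih fun e he => hl e (List.mem_cons_of_mem _ he))
      have hr : toFreeGroup P.1 e.2.1 ∈ Subgroup.normalClosure (relators P) :=
        Subgroup.subset_normalClosure ⟨e.2.1, hl e List.mem_cons_self, rfl⟩
      rw [toFreeGroup_append, toFreeGroup_append, toFreeGroup_invRev, ← mul_assoc]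
      refine Subgroup.normalClosure_normal.conj_mem _ ?_ _
      cases e.2.2
      · rw [cond_false, toFreeGroup_invRev]
        exact inv_mem hr
      · exact hr

/-- The half of the word problem that is available for every finite presentation: search for a
product of conjugates of relators equal to the word in the free group, where equality is decidable.
-/
theorem semiDec_elem_eq_one : SemiDec fun x : FinPresCode × GroupWord => elem x.1 x.2 = 1 := by
  have : SemiDec fun x : FinPresCode × GroupWord =>
      ∃ l : List (GroupWord × GroupWord × Bool), (∀ e ∈ l, e.2.1 ∈ x.1.2) ∧
        toFreeGroup x.1.1 x.2 = toFreeGroup x.1.1 (conjProd l) := by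
    refine SemiDec.exists_primrecPred (PrimrecPred.and ?_ ?_)
    · refine PrimrecPred.forall_mem Primrec.snd (PrimrecRel.mem_list.comp ?_ ?_)
      · exact Primrec.snd.comp (Primrec.fst.comp (Primrec.fst.comp Primrec.fst))
      · exact Primrec.fst.comp (Primrec.snd.comp Primrec.snd)
    · exact primrecPred_toFreeGroup_eq (Primrec.fst.comp (Primrec.fst.comp Primrec.fst))
        (Primrec.snd.comp Primrec.fst) (primrec_conjProd.comp Primrec.snd)
  refine this.of_eq fun x => ?_
  rw [elem, PresentedGroup.mk_eq_one_iff, mem_normalClosure_relators_iff]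

end FinPresCode

/-! ### Certificates of nontriviality -/

/-- The action of a letter on `ℕ` coded by a table, which lists for each index the initial values of
two functions; all other points are fixed. -/
def letterAct (t : List (List ℕ × List ℕ)) (x : ℕ × Bool) (j : ℕ) : ℕ :=
  (bif x.2 then (t.getD x.1 ([], [])).1 else (t.getD x.1 ([], [])).2).getD j j

/-- The action of a word on `ℕ` coded by a table. -/
def wordAct (t : List (List ℕ × List ℕ)) (w : GroupWord) (j : ℕ) : ℕ :=
  w.foldr (letterAct t) j

theorem primrec_letterAct :
    Primrec fun y : (List (List ℕ × List ℕ) × (ℕ × Bool)) × ℕ => letterAct y.1.1 y.1.2 y.2 := by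
  have h : Primrec fun y : (List (List ℕ × List ℕ) × (ℕ × Bool)) × ℕ =>
      y.1.1.getD y.1.2.1 ([], []) :=
    (Primrec.list_getD _).comp (Primrec.fst.comp Primrec.fst)
      (Primrec.fst.comp (Primrec.snd.comp Primrec.fst))
  have hl := Primrec.cond (Primrec.snd.comp (Primrec.snd.comp Primrec.fst))
    (Primrec.fst.comp h) (Primrec.snd.comp h)
  refine (Primrec.option_getD.comp (Primrec.list_getElem?.comp hl Primrec.snd)
    Primrec.snd).of_eq fun y => ?_
  simp only [letterAct, List.getD_eq_getElem?_getD]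

theorem primrec_wordAct :
    Primrec fun y : (List (List ℕ × List ℕ) × GroupWord) × ℕ => wordAct y.1.1 y.1.2 y.2 := by
  have h := Primrec.snd (α := (List (List ℕ × List ℕ) × GroupWord) × ℕ) (β := (ℕ × Bool) × ℕ)
  exact Primrec.list_foldr (Primrec.snd.comp Primrec.fst) Primrec.snd
    (primrec_letterAct.comp (((Primrec.fst.comp (Primrec.fst.comp Primrec.fst)).pair
      (Primrec.fst.comp h)).pair (Primrec.snd.comp h))).to₂

namespace FinPresCode

open GroupWord

/-- A table codes an action of the group `P` by permutations of `{0, …, B - 1}`. -/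
structure IsPermTable (P : FinPresCode) (t : List (List ℕ × List ℕ)) (B : ℕ) : Prop where
  -- The first two fields make letters of index at least `P.1` act trivially and points from `B` on
  -- stay fixed. The finitely many checks in the last two fields therefore hold on all of ℕ, and {0,
  -- …, B - 1} is automatically invariant.
  length_le : t.length ≤ P.1
  bound : ∀ e ∈ t, e.1.length ≤ B ∧ e.2.length ≤ B
  inverse : ∀ i ∈ List.range P.1, ∀ j ∈ List.range B,
    letterAct t (i, true) (letterAct t (i, false) j) = j ∧
      letterAct t (i, false) (letterAct t (i, true) j) = j
  relator : ∀ r ∈ P.2, ∀ j ∈ List.range B, wordAct t r j = j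

theorem isPermTable_iff (P : FinPresCode) (t : List (List ℕ × List ℕ)) (B : ℕ) :
    IsPermTable P t B ↔ t.length ≤ P.1 ∧ (∀ e ∈ t, e.1.length ≤ B ∧ e.2.length ≤ B) ∧
      (∀ i ∈ List.range P.1, ∀ j ∈ List.range B,
        letterAct t (i, true) (letterAct t (i, false) j) = j ∧
          letterAct t (i, false) (letterAct t (i, true) j) = j) ∧
      ∀ r ∈ P.2, ∀ j ∈ List.range B, wordAct t r j = j :=
  ⟨fun h => ⟨h.1, h.2, h.3, h.4⟩, fun h => ⟨h.1, h.2.1, h.2.2.1, h.2.2.2⟩⟩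

theorem primrecPred_isPermTable :
    PrimrecPred fun x : FinPresCode × List (List ℕ × List ℕ) × ℕ =>
      IsPermTable x.1 x.2.1 x.2.2 := by
  have hn : Primrec fun x : FinPresCode × List (List ℕ × List ℕ) × ℕ => x.1.1 :=
    Primrec.fst.comp Primrec.fst
  have hR : Primrec fun x : FinPresCode × List (List ℕ × List ℕ) × ℕ => x.1.2 :=
    Primrec.snd.comp Primrec.fst
  have ht : Primrec fun x : FinPresCode × List (List ℕ × List ℕ) × ℕ => x.2.1 :=
    Primrec.fst.comp Primrec.snd
  have hB : Primrec fun x : FinPresCode × List (List ℕ × List ℕ) × ℕ => x.2.2 :=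
    Primrec.snd.comp Primrec.snd
  refine PrimrecPred.of_eq ?_ fun x => (isPermTable_iff _ _ _).symm
  refine (Primrec.nat_le.comp (Primrec.list_length.comp ht) hn).and (.and ?_ (.and ?_ ?_))
  · refine PrimrecPred.forall_mem ht (.and ?_ ?_)
    · exact Primrec.nat_le.comp (Primrec.list_length.comp (Primrec.fst.comp Primrec.snd))
        (hB.comp Primrec.fst)
    · exact Primrec.nat_le.comp (Primrec.list_length.comp (Primrec.snd.comp Primrec.snd))
        (hB.comp Primrec.fst)
  · refine PrimrecPred.forall_mem (Primrec.list_range.comp hn)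
      (PrimrecPred.forall_mem (Primrec.list_range.comp (hB.comp Primrec.fst)) ?_)
    have ht' := ht.comp (Primrec.fst.comp (Primrec.fst
      (α := (FinPresCode × List (List ℕ × List ℕ) × ℕ) × ℕ) (β := ℕ)))
    have hi := Primrec.snd.comp (Primrec.fst
      (α := (FinPresCode × List (List ℕ × List ℕ) × ℕ) × ℕ) (β := ℕ))
    have act : ∀ b, ∀ {j : ((FinPresCode × List (List ℕ × List ℕ) × ℕ) × ℕ) × ℕ → ℕ}, Primrec j →
        Primrec fun y => letterAct y.1.1.2.1 (y.1.2, b) (j y) := fun b j hj =>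
      primrec_letterAct.comp ((ht'.pair (hi.pair (Primrec.const b))).pair hj)
    exact (Primrec.eq.comp (act _ (act _ Primrec.snd)) Primrec.snd).and
      (Primrec.eq.comp (act _ (act _ Primrec.snd)) Primrec.snd)
  · refine PrimrecPred.forall_mem hR
      (PrimrecPred.forall_mem (Primrec.list_range.comp (hB.comp Primrec.fst)) ?_)
    have h : Primrec fun y : ((FinPresCode × List (List ℕ × List ℕ) × ℕ) × GroupWord) × ℕ =>
        ((y.1.1.2.1, y.1.2), y.2) :=
      ((ht.comp (Primrec.fst.comp Primrec.fst)).pair (Primrec.snd.comp Primrec.fst)).pair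
        Primrec.snd
    have h' := primrec_wordAct.comp h
    exact Primrec.eq.comp h' Primrec.snd

section IsPermTable

variable {P : FinPresCode} {t : List (List ℕ × List ℕ)} {B : ℕ}

theorem IsPermTable.letterAct_of_le (h : IsPermTable P t B) (x : ℕ × Bool) {j : ℕ} (hj : B ≤ j) :
    letterAct t x j = j := by
  apply List.getD_eq_default
  refine le_trans ?_ hj
  by_cases hx : x.1 < t.length
  · have := h.bound _ (List.getElem_mem hx)
    rw [List.getD_eq_getElem _ _ hx]
    cases x.2
    exacts [this.2, this.1]
  · rw [List.getD_eq_default _ _ (not_lt.1 hx)]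
    cases x.2 <;> exact Nat.zero_le _

theorem IsPermTable.wordAct_of_le (h : IsPermTable P t B) (w : GroupWord) {j : ℕ} (hj : B ≤ j) :
    wordAct t w j = j := by
  induction w with
  | nil => rfl
  | cons x w ih =>
    change letterAct t x (wordAct t w j) = j
    rw [ih, h.letterAct_of_le x hj]

theorem IsPermTable.letterAct_of_index_le (h : IsPermTable P t B) {i : ℕ} (hi : P.1 ≤ i) (b : Bool)
    (j : ℕ) : letterAct t (i, b) j = j := by
  rw [letterAct, List.getD_eq_default _ _ (h.length_le.trans hi)]
  cases b <;> rfl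

theorem IsPermTable.letterAct_inverse (h : IsPermTable P t B) (i j : ℕ) :
    letterAct t (i, true) (letterAct t (i, false) j) = j ∧
      letterAct t (i, false) (letterAct t (i, true) j) = j := by
  by_cases hi : i < P.1
  · by_cases hj : j < B
    · exact h.inverse i (List.mem_range.2 hi) j (List.mem_range.2 hj)
    · simp only [h.letterAct_of_le _ (not_lt.1 hj), and_self]
  · simp only [h.letterAct_of_index_le (not_lt.1 hi), and_self]

/-- The permutation of `ℕ` by which a letter acts. -/
def IsPermTable.perm (h : IsPermTable P t B) (i : ℕ) : Equiv.Perm ℕ where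
  toFun := letterAct t (i, true)
  invFun := letterAct t (i, false)
  left_inv j := (h.letterAct_inverse i j).2
  right_inv j := (h.letterAct_inverse i j).1

theorem IsPermTable.eval_perm (h : IsPermTable P t B) (w : GroupWord) (j : ℕ) :
    eval h.perm w j = wordAct t w j := by
  induction w with
  | nil => rfl
  | cons x w ih =>
    obtain ⟨i, b⟩ := x
    rw [eval_cons, Equiv.Perm.mul_apply, ih]
    cases b <;> rfl

theorem IsPermTable.lift_toFreeGroup (h : IsPermTable P t B) (w : GroupWord) :
    FreeGroup.lift (fun i : Fin P.1 => h.perm i) (toFreeGroup P.1 w) = eval h.perm w := by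
  rw [toFreeGroup_eq_eval, ← eval_comp]
  congr 1
  ext i j
  by_cases hi : i < P.1
  · simp [hi]
  · simp only [hi, dite_false, map_one, Equiv.Perm.one_apply]
    exact (h.letterAct_of_index_le (not_lt.1 hi) true j).symm

/-- Soundness of certificates: the permutations of the table satisfy the relators, so the action
factors through the coded group. -/
theorem IsPermTable.wordAct_eq_self (h : IsPermTable P t B) {w : GroupWord} (hw : elem P w = 1)
    (j : ℕ) : wordAct t w j = j := by
  have hrel : ∀ r ∈ relators P, FreeGroup.lift (fun i : Fin P.1 => h.perm i) r = 1 := by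
    rintro _ ⟨r, hr, rfl⟩
    rw [h.lift_toFreeGroup]
    ext j
    rw [h.eval_perm]
    by_cases hj : j < B
    · exact h.relator r hr j (List.mem_range.2 hj)
    · exact h.wordAct_of_le r (not_lt.1 hj)
  have key : PresentedGroup.toGroup hrel (elem P w) = eval h.perm w := by
    rw [← h.lift_toFreeGroup]; rfl
  rw [← h.eval_perm, ← key, hw, map_one, Equiv.Perm.one_apply]

end IsPermTable

/-- Cayley's theorem: number the elements of the group and tabulate its left regular action. A
nontrivial element moves the number of the identity. -/
theorem exists_isPermTable (P : FinPresCode) [Finite (group P)] :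
    ∃ t B, IsPermTable P t B ∧ ∀ w, elem P w ≠ 1 → ∃ j, wordAct t w j ≠ j := by
  obtain ⟨B, ⟨e⟩⟩ := Finite.exists_equiv_fin (group P)
  let tab : group P → List ℕ := fun g => List.ofFn fun j : Fin B => ((e (g * e.symm j) : Fin B) : ℕ)
  let t : List (List ℕ × List ℕ) :=
    List.ofFn fun i : Fin P.1 => (tab (P.gen i), tab (P.gen i)⁻¹)
  have htab : ∀ g x, (tab g).getD (e x) (e x) = e (g * x) := fun g x => by
    rw [List.getD_eq_getElem _ _ (by simp [tab])]
    simp [tab]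
  have hletter : ∀ i b x, letterAct t (i, b) (e x) =
      e ((if b then P.gen i else (P.gen i)⁻¹) * x) := fun i b x => by
    by_cases hi : i < P.1
    · have : t.getD i ([], []) = (tab (P.gen i), tab (P.gen i)⁻¹) := by
        rw [List.getD_eq_getElem _ _ (by simpa [t] using hi)]
        simp [t]
      rw [letterAct, this]
      cases b <;> simp [htab, -List.getD_eq_getElem?_getD]
    · have h₁ : P.gen i = 1 := by simp [gen, hi]
      have h₂ : t.getD i ([], []) = ([], []) :=
        List.getD_eq_default _ _ (by simpa [t] using hi)
      rw [letterAct, h₁, h₂]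
      cases b <;> simp
  have hword : ∀ w x, wordAct t w (e x) = e (elem P w * x) := fun w x => by
    rw [elem_eq_eval]
    induction w with
    | nil => simp [wordAct]
    | cons y w ih =>
      change letterAct t y (wordAct t w (e x)) = _
      rw [ih, hletter, eval_cons, mul_assoc]
  have hsurj : ∀ j ∈ List.range B, ∃ x, j = e x := fun j hj =>
    ⟨e.symm ⟨j, List.mem_range.1 hj⟩, by simp⟩
  refine ⟨t, B, ⟨by simp [t], ?_, ?_, ?_⟩, fun w hw => ⟨e 1, ?_⟩⟩
  · intro x hx
    obtain ⟨i, rfl⟩ := (List.mem_ofFn' _ _).1 hx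
    simp [tab]
  · intro i _ j hj
    obtain ⟨x, rfl⟩ := hsurj j hj
    simp [hletter]
  · intro r hr j hj
    obtain ⟨x, rfl⟩ := hsurj j hj
    have : elem P r = 1 := PresentedGroup.one_of_mem ⟨r, hr, rfl⟩
    rw [hword, this, one_mul]
  · rw [hword, mul_one]
    exact fun h => hw (e.injective (Fin.val_injective h))

/-- Some action of the group coded by a table moves a point under the given word. -/
def Separated (P : FinPresCode) (w : GroupWord) : Prop :=
  ∃ c : (List (List ℕ × List ℕ) × ℕ) × ℕ, IsPermTable P c.1.1 c.1.2 ∧ wordAct c.1.1 w c.2 ≠ c.2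

theorem separated_iff (P : FinPresCode) [Finite (group P)] (w : GroupWord) :
    Separated P w ↔ elem P w ≠ 1 := by
  constructor
  · rintro ⟨⟨⟨t, B⟩, j⟩, h, hj⟩ hw
    exact hj (h.wordAct_eq_self hw j)
  · intro hw
    obtain ⟨t, B, h, H⟩ := exists_isPermTable P
    obtain ⟨j, hj⟩ := H w hw
    exact ⟨((t, B), j), h, hj⟩

theorem semiDec_separated : SemiDec fun x : FinPresCode × GroupWord => Separated x.1 x.2 := by
  have hc := Primrec.snd (α := FinPresCode × GroupWord)
    (β := (List (List ℕ × List ℕ) × ℕ) × ℕ)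
  refine SemiDec.exists_primrecPred ((primrecPred_isPermTable.comp
    ((Primrec.fst.comp Primrec.fst).pair (Primrec.fst.comp hc))).and ?_)
  exact (Primrec.eq.comp (primrec_wordAct.comp (((Primrec.fst.comp (Primrec.fst.comp hc)).pair
    (Primrec.snd.comp Primrec.fst)).pair (Primrec.snd.comp hc))) (Primrec.snd.comp hc)).not

end FinPresCode

/-! ### Words for homomorphisms between free groups -/

namespace GroupWord

variable {S S' : Type} {m : ℕ} (e : S ≃ Fin m) (ι' : S' → ℕ)

/-- A word spelling an element of the free group on `S`, whose generators are numbered by `ι`. -/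
def ofFree (ι : S → ℕ) (x : FreeGroup S) : GroupWord := (FreeGroup.map ι x).toWord

theorem eval_ofFree {H : Type*} [Group H] (ρ : ℕ → H) (ι : S → ℕ) (x : FreeGroup S) :
    eval ρ (ofFree ι x) = FreeGroup.lift (fun s => ρ (ι s)) x := by
  rw [ofFree, eval_toWord, ← MonoidHom.comp_apply]
  congr 1
  ext s
  simp

theorem getD_ofFn {α : Type*} (f : Fin m → α) (j : Fin m) (d : α) :
    (List.ofFn f).getD j d = f j := by
  rw [List.getD_eq_getElem _ _ (by simp)]
  simp

/-- A tuple of words spelling given elements of a free group. -/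
def tuple (g : S → FreeGroup S') : List GroupWord :=
  List.ofFn fun j => ofFree ι' (g (e.symm j))

theorem getD_tuple (g : S → FreeGroup S') (s : S) :
    (tuple e ι' g).getD (e s) [] = ofFree ι' (g s) := by
  rw [tuple, getD_ofFn, e.symm_apply_apply]

/-- Precomposition with `σ` is carried out on words by substituting the tuple of images of the
generators. -/
theorem lift_eval_tuple {H : Type*} [Group H] (ρ : ℕ → H) (σ : Monoid.End (FreeGroup S))
    (ι : S → ℕ) (x : FreeGroup S) :
    FreeGroup.lift (fun s => eval ρ ((tuple e ι fun s => σ (FreeGroup.of s)).getD (e s) [])) x =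
      FreeGroup.lift (fun s => ρ (ι s)) (σ x) := by
  refine DFunLike.congr_fun (g := (FreeGroup.lift fun s => ρ (ι s)).comp
    (show FreeGroup S →* FreeGroup S from σ)) ?_ x
  ext s
  rw [FreeGroup.lift_apply_of, getD_tuple, eval_ofFree]
  rfl

end GroupWord

/-! ### A criterion for the existence of homomorphisms -/

/-- If φ exists, `lift f` is φ composed with `lift s`, so it respects every identity that holds in
`G`. Conversely, the relator conditions make `lift f ∘ W` descend to `L.group`; the middle condition
then ensures that the descended map takes the prescribed values on the family. -/
theorem LPresentation.exists_hom_iff {G : Type*} [Group G] {S : Type} {L : LPresentation S}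
    (e : G ≃* L.group) {ι : Type*} {s : ι → G} {W : FreeGroup S →* FreeGroup ι}
    {U : ι → FreeGroup S} (hW : ∀ x, e (FreeGroup.lift s (W x)) = PresentedGroup.mk _ x)
    (hU : ∀ i, e (s i) = PresentedGroup.mk _ (U i)) {F : Type*} [Group F] (f : ι → F) :
    (∃ φ : G →* F, ∀ i, φ (s i) = f i) ↔
      (∀ r ∈ L.fixedRels, FreeGroup.lift f (W r) = 1) ∧
        (∀ i, FreeGroup.lift f (W (U i)) = f i) ∧
          ∀ σ ∈ Submonoid.closure (L.endos : Set (Monoid.End (FreeGroup S))),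
            ∀ r ∈ L.iteratedRels, FreeGroup.lift f (W (σ r)) = 1 := by
  constructor
  · rintro ⟨φ, hφ⟩
    have key : ∀ x, FreeGroup.lift f x = φ (FreeGroup.lift s x) := fun x => by
      rw [← MonoidHom.comp_apply]
      congr 1
      ext i
      simp [hφ]
    have hW' : ∀ x, FreeGroup.lift s (W x) = e.symm (PresentedGroup.mk _ x) := fun x => by
      rw [← hW, e.symm_apply_apply]
    have hrel : ∀ x ∈ L.relators, FreeGroup.lift f (W x) = 1 := fun x hx => by
      have : PresentedGroup.mk L.relators x = 1 := PresentedGroup.one_of_mem hx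
      rw [key, hW', this, map_one, map_one]
    refine ⟨fun r hr => hrel r (Or.inl hr), fun i => ?_,
      fun σ hσ r hr => hrel _ (Or.inr ⟨σ, hσ, r, hr, rfl⟩)⟩
    rw [key, hW', ← hU, e.symm_apply_apply, hφ]
  · rintro ⟨h₁, h₂, h₃⟩
    have hlift : FreeGroup.lift (fun a => FreeGroup.lift f (W (FreeGroup.of a))) =
        (FreeGroup.lift f).comp W := by
      ext a
      simp
    have hrel : ∀ r ∈ L.relators,
        FreeGroup.lift (fun a => FreeGroup.lift f (W (FreeGroup.of a))) r = 1 := by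
      rw [hlift]
      rintro _ (hr | ⟨σ, hσ, r, hr, rfl⟩)
      exacts [h₁ _ hr, h₃ σ hσ r hr]
    refine ⟨(PresentedGroup.toGroup hrel).comp e.toMonoidHom, fun i => ?_⟩
    have : PresentedGroup.toGroup hrel (PresentedGroup.mk _ (U i)) =
        FreeGroup.lift (fun a => FreeGroup.lift f (W (FreeGroup.of a))) (U i) := rfl
    rw [MonoidHom.comp_apply]
    change PresentedGroup.toGroup hrel (e (s i)) = _
    rw [hU, this, hlift, MonoidHom.comp_apply, h₂]

theorem IsLPresented.fg {G : Type*} [Group G] (hG : IsLPresented G) : Group.FG G := by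
  obtain ⟨S, _, L, ⟨e⟩⟩ := hG
  have : Group.FG L.group := inferInstanceAs (Group.FG (_ ⧸ _))
  exact Group.fg_of_surjective (f := e.symm.toMonoidHom) e.symm.surjective

/-! ### The two semidecision procedures -/

namespace FinPresCode

open GroupWord

/-- Finite lists of words that together decide, given the values of the generators in the group of a
presentation, whether these values extend to a homomorphism: a list of words to be killed, and a
list of tuples describing endomorphisms under whose iterates another list of words, to be
substituted into a tuple, has to be killed. -/
structure Test where
  arity : ℕ
  fixed : List GroupWord
  start : List GroupWord
  endos : List (List GroupWord)
  iterated : List GroupWord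

namespace Test

variable (T : Test)

/-- The tuple with which the iteration starts. -/
def initial (f : List GroupWord) : List GroupWord := T.start.map (subst f)

/-- A finite family of tuples, closed under the endomorphisms up to equality in the group, shows
that all iterates of the words are killed. -/
def Accepts (x : FinPresCode × List GroupWord) : Prop :=
  (∀ w ∈ T.fixed, elem x.1 (subst x.2 w) = 1) ∧
    ∃ C : List (List GroupWord), T.initial x.2 ∈ C ∧ ∀ t ∈ C,
      (∀ r ∈ T.iterated, elem x.1 (subst t r) = 1) ∧
        -- Closure is asked only up to equality in the group, since substitution produces ever
        -- longer words and a literally closed finite family need not exist.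
        ∀ σ ∈ T.endos, ∃ t' ∈ C, ∀ j ∈ List.range T.arity,
          elem x.1 (subst t (σ.getD j []) ++ FreeGroup.invRev (t'.getD j [])) = 1

/-- One of the words is not killed. -/
def Rejects (x : FinPresCode × List GroupWord) : Prop :=
  (∃ w ∈ T.fixed, Separated x.1 (subst x.2 w)) ∨
    ∃ l : List (List GroupWord), (∀ σ ∈ l, σ ∈ T.endos) ∧ ∃ r ∈ T.iterated,
      Separated x.1 (subst (T.initial x.2) (l.foldr subst r))

theorem primrec_initial : Primrec T.initial :=
  Primrec.list_map (Primrec.const _) primrec_subst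

/-- Equality in the group occurs only positively and all universal quantifiers range over finite
lists, so the closure properties of `SemiDec` suffice. -/
theorem semiDec_accepts : SemiDec T.Accepts := by
  refine .and (.forall_mem (Primrec.const _) ?_) (.exists_ (.and ?_ (.forall_mem Primrec.snd
    (.and (.forall_mem (Primrec.const _) ?_) (.forall_mem (Primrec.const _)
      (.exists_mem (Primrec.snd.comp (Primrec.fst.comp Primrec.fst))
        (.forall_mem (Primrec.const _) ?_)))))))
  · exact semiDec_elem_eq_one.comp ((Primrec.fst.comp Primrec.fst).pair
      (primrec_subst.comp (Primrec.snd.comp Primrec.fst) Primrec.snd))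
  · exact .of_primrecPred (PrimrecRel.mem_list.comp Primrec.snd
      (T.primrec_initial.comp (Primrec.snd.comp Primrec.fst)))
  · exact semiDec_elem_eq_one.comp ((Primrec.fst.comp (Primrec.fst.comp (Primrec.fst.comp
      Primrec.fst))).pair (primrec_subst.comp (Primrec.snd.comp Primrec.fst) Primrec.snd))
  · have h : Primrec fun y : (((((FinPresCode × List GroupWord) × List (List GroupWord)) ×
        List GroupWord) × List GroupWord) × List GroupWord) × ℕ =>
        (y.1.1.1.1.1.1, subst y.1.1.1.2 (y.1.1.2.getD y.2 []) ++
          FreeGroup.invRev (y.1.2.getD y.2 [])) := by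
      have h₁ := Primrec.fst (α := ((((FinPresCode × List GroupWord) × List (List GroupWord)) ×
        List GroupWord) × List GroupWord) × List GroupWord) (β := ℕ)
      have h₂ := Primrec.fst.comp h₁
      have h₃ := Primrec.fst.comp h₂
      refine (Primrec.fst.comp (Primrec.fst.comp (Primrec.fst.comp h₃))).pair
        (Primrec.list_append.comp (primrec_subst.comp (Primrec.snd.comp h₃)
          ((Primrec.list_getD []).comp (Primrec.snd.comp h₂) Primrec.snd))
          (FreeGroup.primrec_invRev.comp
            ((Primrec.list_getD []).comp (Primrec.snd.comp h₁) Primrec.snd)))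
    exact semiDec_elem_eq_one.comp h

theorem semiDec_rejects : SemiDec T.Rejects := by
  refine .or (.exists_mem (Primrec.const _) ?_) (.exists_ (.and
    (.forall_mem Primrec.snd ?_) (.exists_mem (Primrec.const _) ?_)))
  · exact semiDec_separated.comp ((Primrec.fst.comp Primrec.fst).pair
      (primrec_subst.comp (Primrec.snd.comp Primrec.fst) Primrec.snd))
  · exact .of_primrecPred (PrimrecRel.mem_list.comp (Primrec.const _) Primrec.snd)
  · have h : Primrec fun y : ((FinPresCode × List GroupWord) × List (List GroupWord)) ×
        GroupWord => (y.1.1.1, subst (T.initial y.1.1.2) (y.1.2.foldr subst y.2)) := by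
      have h₁ := Primrec.fst (α := (FinPresCode × List GroupWord) × List (List GroupWord))
        (β := GroupWord)
      have h₂ := Primrec.fst.comp h₁
      have h₃ := T.primrec_initial.comp (Primrec.snd.comp h₂)
      have h₄ : Primrec fun y : ((FinPresCode × List GroupWord) × List (List GroupWord)) ×
          GroupWord => y.1.2.foldr subst y.2 :=
        Primrec.list_foldr (h := fun _ z => subst z.1 z.2) (Primrec.snd.comp h₁) Primrec.snd
          (primrec_subst.comp (Primrec.fst.comp Primrec.snd) (Primrec.snd.comp Primrec.snd))
      have h₅ := primrec_subst.comp h₃ h₄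
      exact (Primrec.fst.comp h₂).pair h₅
    have h' := semiDec_separated.comp h
    exact h'

end Test

end FinPresCode


/-! ### Correctness -/

namespace LPresentation

open GroupWord FinPresCode

variable {S : Type} {m k : ℕ} (L : LPresentation S) (e : S ≃ Fin m)
  (W : FreeGroup S →* FreeGroup (Fin k)) (U : Fin k → FreeGroup S)

/-- The tuple of words spelling the images of the generators under an endomorphism. -/
def endoTuple (σ : Monoid.End (FreeGroup S)) : List GroupWord :=
  tuple e (fun s => (e s : ℕ)) fun s => σ (FreeGroup.of s)

/-- The test deciding whether values of the members of a generating family extend to a homomorphism: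
`W` expresses the generators of the L-presentation in terms of the family, and `U` expresses the
family in terms of the generators. -/
noncomputable def test : FinPresCode.Test where
  arity := m
  fixed := (L.fixedRels.toList.map fun r => ofFree Fin.val (W r)) ++
    -- These words express that each member of the family, rewritten through `S` and back, keeps its
    -- value.
    List.ofFn fun i => ofFree Fin.val (W (U i) * (FreeGroup.of i)⁻¹)
  start := tuple e Fin.val fun s => W (FreeGroup.of s)
  endos := L.endos.toList.map (endoTuple e)
  iterated := L.iteratedRels.toList.map (ofFree fun s => (e s : ℕ))

variable {P : FinPresCode}

/-- The homomorphism described by a tuple of words. -/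
def tupleHom (P : FinPresCode) (t : List GroupWord) : FreeGroup S →* FinPresCode.group P :=
  FreeGroup.lift fun s => elem P (t.getD (e s) [])

theorem elem_subst (t : List GroupWord) (w : GroupWord) :
    elem P (subst t w) = eval (fun i => elem P (t.getD i [])) w := by
  simp only [elem_eq_eval, eval_subst]

theorem elem_subst_ofFree (t : List GroupWord) (x : FreeGroup S) :
    elem P (subst t (ofFree (fun s => (e s : ℕ)) x)) = tupleHom e P t x := by
  rw [elem_subst, eval_ofFree, tupleHom]

theorem elem_subst_input (f : Fin k → GroupWord) (x : FreeGroup (Fin k)) :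
    elem P (subst (List.ofFn f) (ofFree Fin.val x)) = FreeGroup.lift (fun i => elem P (f i)) x := by
  rw [elem_subst, eval_ofFree]
  simp only [getD_ofFn]

theorem tupleHom_initial (f : Fin k → GroupWord) :
    tupleHom e P ((test L e W U).initial (List.ofFn f)) =
      (FreeGroup.lift fun i => elem P (f i)).comp W := by
  ext s
  have : ((test L e W U).initial (List.ofFn f)).getD (e s) [] =
      subst (List.ofFn f) ((tuple e Fin.val fun s => W (FreeGroup.of s)).getD (e s) []) :=
    -- The default values match because substituting into the empty word gives the empty word.
    List.getD_map (d := []) (f := subst (List.ofFn f)) ..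
  rw [tupleHom, FreeGroup.lift_apply_of, this, getD_tuple, elem_subst_input, MonoidHom.comp_apply]

/-- Iterated substitution realizes the composite of the endomorphisms. The induction must vary `ρ`,
because the outermost substitution is absorbed into a new evaluation of the letters. -/
theorem eval_foldr_subst {H : Type*} [Group H] (ρ : ℕ → H)
    (l : List (Monoid.End (FreeGroup S))) (x : FreeGroup S) :
    eval ρ ((l.map (endoTuple e)).foldr subst
      (ofFree (fun s => (e s : ℕ)) x)) = FreeGroup.lift (fun s => ρ (e s)) (l.prod x) := by
  induction l generalizing ρ with
  | nil => exact eval_ofFree _ _ _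
  | cons σ l ih =>
    rw [List.map_cons, List.foldr_cons, eval_subst, ih, endoTuple, lift_eval_tuple, List.prod_cons]
    rfl

/-- Homomorphisms out of a free group agree as soon as they agree on the generators, so finitely
many word equalities suffice. -/
theorem forall_range_elem_eq_one_iff (σ : Monoid.End (FreeGroup S)) (t t' : List GroupWord) :
    (∀ j ∈ List.range m, elem P (subst t ((endoTuple e σ).getD j []) ++
      FreeGroup.invRev (t'.getD j [])) = 1) ↔
        ∀ x, tupleHom e P t (σ x) = tupleHom e P t' x := by
  have key : ∀ s, elem P (subst t ((endoTuple e σ).getD (e s) []) ++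
      FreeGroup.invRev (t'.getD (e s) [])) = 1 ↔
        tupleHom e P t (σ (FreeGroup.of s)) = tupleHom e P t' (FreeGroup.of s) := fun s => by
    rw [elem_append, elem_invRev, mul_inv_eq_one, endoTuple, getD_tuple, elem_subst_ofFree]
    simp [tupleHom]
  constructor
  · intro h
    refine DFunLike.congr_fun (f := (tupleHom e P t).comp
      (show FreeGroup S →* FreeGroup S from σ)) ?_
    ext s
    exact (key s).1 (h _ (List.mem_range.2 (e s).2))
  · intro h j hj
    have := (key (e.symm ⟨j, List.mem_range.1 hj⟩)).2 (h _)
    simpa only [e.apply_symm_apply] using this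

theorem exists_tupleHom_eq (h : FreeGroup S →* FinPresCode.group P) :
    ∃ t, tupleHom e P t = h := by
  choose w hw using fun j => elem_surjective P (h (FreeGroup.of (e.symm j)))
  refine ⟨List.ofFn w, ?_⟩
  ext s
  rw [tupleHom, FreeGroup.lift_apply_of, getD_ofFn, hw, e.symm_apply_apply]

theorem fixed_iff (f : Fin k → GroupWord) :
    (∀ w ∈ (test L e W U).fixed, elem P (subst (List.ofFn f) w) = 1) ↔
      (∀ r ∈ L.fixedRels, FreeGroup.lift (fun i => elem P (f i)) (W r) = 1) ∧
        ∀ i, FreeGroup.lift (fun i => elem P (f i)) (W (U i)) = elem P (f i) := by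
  simp only [test, List.forall_mem_append, List.forall_mem_map, Finset.mem_toList,
    List.forall_mem_ofFn_iff, elem_subst_input, map_mul, map_inv, FreeGroup.lift_apply_of,
    mul_inv_eq_one]

/-- Soundness: closure under Φ propagates to Φ*, so each iterate of the initial homomorphism is
described by a member of the family and kills R₂. Completeness: the orbit under Φ* is finite, and
one tuple for each of its members gives a certificate. -/
theorem accepts_iff [Finite (FinPresCode.group P)] (f : Fin k → GroupWord) :
    (test L e W U).Accepts (P, List.ofFn f) ↔
      (∀ r ∈ L.fixedRels, FreeGroup.lift (fun i => elem P (f i)) (W r) = 1) ∧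
        (∀ i, FreeGroup.lift (fun i => elem P (f i)) (W (U i)) = elem P (f i)) ∧
          ∀ σ ∈ Submonoid.closure (L.endos : Set (Monoid.End (FreeGroup S))),
            ∀ r ∈ L.iteratedRels, FreeGroup.lift (fun i => elem P (f i)) (W (σ r)) = 1 := by
  rw [Test.Accepts, fixed_iff, and_assoc]
  refine and_congr_right fun _ => and_congr_right fun _ => ?_
  have hinit : ∀ x, _ = FreeGroup.lift (fun i => elem P (f i)) (W x) :=
    DFunLike.congr_fun (tupleHom_initial (P := P) L e W U f)
  have hiter : ∀ t, (∀ r ∈ (test L e W U).iterated, elem P (subst t r) = 1) ↔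
      ∀ r ∈ L.iteratedRels, tupleHom e P t r = 1 := fun t => by
    simp only [test, List.forall_mem_map, Finset.mem_toList, elem_subst_ofFree]
  have hendo : ∀ (C : List (List GroupWord)) (t : List GroupWord),
      (∀ σ ∈ (test L e W U).endos, ∃ t' ∈ C, ∀ j ∈ List.range (test L e W U).arity,
        elem P (subst t (σ.getD j []) ++ FreeGroup.invRev (t'.getD j [])) = 1) ↔
      ∀ σ ∈ L.endos, ∃ t' ∈ C, ∀ x, tupleHom e P t (σ x) = tupleHom e P t' x := fun C t => by
    simp only [test, List.forall_mem_map, Finset.mem_toList, forall_range_elem_eq_one_iff]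
  simp only [hiter, hendo]
  constructor
  · rintro ⟨C, hC, H⟩ σ hσ r hr
    have key : ∀ t ∈ C, ∃ t' ∈ C, ∀ x, tupleHom e P t (σ x) = tupleHom e P t' x := by
      induction hσ using Submonoid.closure_induction with
      | mem σ hσ => exact fun t ht => (H t ht).2 σ hσ
      | one => exact fun t ht => ⟨t, ht, fun _ => rfl⟩
      | mul σ τ _ _ hσ hτ =>
        intro t ht
        obtain ⟨t₁, ht₁, h₁⟩ := hσ t ht
        obtain ⟨t₂, ht₂, h₂⟩ := hτ t₁ ht₁
        exact ⟨t₂, ht₂, fun x => (h₁ _).trans (h₂ x)⟩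
    obtain ⟨t, ht, h⟩ := key _ hC
    have := h r
    rwa [hinit, (H t ht).1 r hr] at this
  · intro H
    choose rep hrep using exists_tupleHom_eq (P := P) e
    have : Finite (FreeGroup S →* FinPresCode.group P) :=
      have := Finite.of_equiv _ e.symm
      Finite.of_equiv _ (FreeGroup.lift (α := S) (β := FinPresCode.group P))
    let h₀ := tupleHom e P ((test L e W U).initial (List.ofFn f))
    let I : Set (FreeGroup S →* FinPresCode.group P) :=
      {h | ∃ σ ∈ Submonoid.closure (L.endos : Set (Monoid.End (FreeGroup S))), ∀ x, h x = h₀ (σ x)}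
    have hI : I.Finite := Set.toFinite I
    -- The initial tuple must itself belong to the family, and the chosen representative of its
    -- homomorphism may be another tuple; hence it is added separately.
    refine ⟨(test L e W U).initial (List.ofFn f) :: hI.toFinset.toList.map rep,
      List.mem_cons_self, fun t ht => ?_⟩
    have htI : tupleHom e P t ∈ I := by
      rcases List.mem_cons.1 ht with rfl | ht
      · exact ⟨1, one_mem _, fun _ => rfl⟩
      · obtain ⟨h, hh, rfl⟩ := List.mem_map.1 ht
        rw [hrep]
        exact hI.mem_toFinset.1 (Finset.mem_toList.1 hh)
    obtain ⟨σ, hσ, h⟩ := htI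
    refine ⟨fun r hr => ?_, fun τ hτ => ?_⟩
    · rw [h, hinit]
      exact H σ hσ r hr
    · obtain ⟨h', hh'⟩ : ∃ h' : FreeGroup S →* FinPresCode.group P, ∀ x, h' x = h₀ ((σ * τ) x) :=
        ⟨h₀.comp (show FreeGroup S →* FreeGroup S from σ * τ), fun _ => rfl⟩
      -- Precomposing h₀ ∘ σ with τ gives h₀ ∘ (σ τ), so the orbit is closed under Φ.
      have hmem : h' ∈ I := ⟨σ * τ, mul_mem hσ (Submonoid.subset_closure hτ), hh'⟩
      refine ⟨rep h', List.mem_cons_of_mem _ (List.mem_map_of_mem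
        (Finset.mem_toList.2 (hI.mem_toFinset.2 hmem))), fun x => ?_⟩
      rw [hrep, h, hh']
      rfl

/-- Elements of Φ* are products of finite lists from Φ, so a failing iterated relator is witnessed
by such a list; finiteness of the group turns nontriviality into `Separated`. -/
theorem rejects_iff [Finite (FinPresCode.group P)] (f : Fin k → GroupWord) :
    (test L e W U).Rejects (P, List.ofFn f) ↔
      ¬ ((∀ r ∈ L.fixedRels, FreeGroup.lift (fun i => elem P (f i)) (W r) = 1) ∧
        (∀ i, FreeGroup.lift (fun i => elem P (f i)) (W (U i)) = elem P (f i)) ∧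
          ∀ σ ∈ Submonoid.closure (L.endos : Set (Monoid.End (FreeGroup S))),
            ∀ r ∈ L.iteratedRels, FreeGroup.lift (fun i => elem P (f i)) (W (σ r)) = 1) := by
  have hfold : ∀ (l : List (Monoid.End (FreeGroup S))) (r : FreeGroup S),
      elem P (subst ((test L e W U).initial (List.ofFn f))
        ((l.map (endoTuple e)).foldr subst
          (ofFree (fun s => (e s : ℕ)) r))) =
        FreeGroup.lift (fun i => elem P (f i)) (W (l.prod r)) := fun l r => by
    rw [elem_subst, eval_foldr_subst]
    exact DFunLike.congr_fun (tupleHom_initial (P := P) L e W U f) _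
  rw [← and_assoc, ← fixed_iff, not_and_or, Test.Rejects]
  simp only [separated_iff]
  refine or_congr (by push Not; rfl) ?_
  push Not
  constructor
  · rintro ⟨l, hl, r, hr, h⟩
    -- The certificate lists tuples of words; they are lifted one by one to endomorphisms in Φ so
    -- that their product makes sense.
    obtain ⟨l, rfl⟩ : ∃ l' : List L.endos,
        (l'.map Subtype.val).map (endoTuple e) = l := by
      clear h
      induction l with
      | nil => exact ⟨[], rfl⟩
      | cons σ l ih =>
        obtain ⟨l', rfl⟩ := ih fun τ hτ => hl τ (List.mem_cons_of_mem _ hτ)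
        obtain ⟨σ, hσ, rfl⟩ := List.mem_map.1 (hl σ List.mem_cons_self)
        exact ⟨⟨σ, Finset.mem_toList.1 hσ⟩ :: l', rfl⟩
    obtain ⟨r, hr', rfl⟩ := List.mem_map.1 hr
    rw [hfold] at h
    refine ⟨(l.map Subtype.val).prod, ?_, r, Finset.mem_toList.1 hr', h⟩
    refine list_prod_mem fun σ hσ => Submonoid.subset_closure ?_
    obtain ⟨σ, _, rfl⟩ := List.mem_map.1 hσ
    exact σ.2
  · rintro ⟨σ, hσ, r, hr, h⟩
    obtain ⟨l, hl, rfl⟩ := Submonoid.exists_list_of_mem_closure hσ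
    refine ⟨l.map (endoTuple e), fun τ hτ => ?_,
      ofFree (fun s => (e s : ℕ)) r, List.mem_map.2 ⟨r, Finset.mem_toList.2 hr, rfl⟩, ?_⟩
    · obtain ⟨σ, hσ, rfl⟩ := List.mem_map.1 hτ
      exact List.mem_map.2 ⟨σ, Finset.mem_toList.2 (hl σ hσ), rfl⟩
    · rwa [hfold]

end LPresentation

theorem mainTheorem12 (G : Type*) [Group G] (hG : IsLPresented G) : HasCFQ G := by
  refine ⟨hG.fg, fun k s hs => ?_⟩
  obtain ⟨S, _, L, ⟨e₀⟩⟩ := hG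
  obtain ⟨m, ⟨e⟩⟩ := Finite.exists_equiv_fin S
  have hsurj : Function.Surjective (FreeGroup.lift s) := by
    rw [← MonoidHom.range_eq_top, FreeGroup.range_lift_eq_closure, hs]
  -- `W₀` and `U` depend only on `G`, its L-presentation and the family, not on the input. They are
  -- finite data built into the algorithm, so a noncomputable choice is allowed.
  choose W₀ hW₀ using fun a : S => hsurj (e₀.symm (PresentedGroup.of a))
  choose U hU using fun i => PresentedGroup.mk_surjective L.relators (e₀ (s i))
  have hW : ∀ x, e₀ (FreeGroup.lift s (FreeGroup.lift W₀ x)) = PresentedGroup.mk L.relators x := by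
    refine DFunLike.congr_fun (f := (e₀.toMonoidHom.comp (FreeGroup.lift s)).comp
      (FreeGroup.lift W₀)) ?_
    ext a
    simp [hW₀, PresentedGroup.of]
  have hin : Primrec fun x : FinPresCode × (Fin k → GroupWord) => (x.1, List.ofFn x.2) :=
    Primrec.fst.pair (Primrec.list_ofFn fun i =>
      Primrec.fin_app.comp Primrec.snd (Primrec.const i))
  obtain ⟨A, hA, H⟩ := SemiDec.exists_partrec_decides
    ((L.test e (FreeGroup.lift W₀) U).semiDec_accepts.comp hin)
    ((L.test e (FreeGroup.lift W₀) U).semiDec_rejects.comp hin)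
  refine ⟨A, hA, fun P f _ => ?_⟩
  -- For finite target groups acceptance and rejection are complementary, which is what makes the
  -- parallel search halt with the right answer.
  obtain ⟨b, hb, hbA⟩ := H (P, f) ((L.rejects_iff e _ U f).trans
    (not_congr (L.accepts_iff e _ U f).symm))
  refine ⟨b, hb, hbA.trans ?_⟩
  rw [L.accepts_iff, LPresentation.exists_hom_iff e₀ hW fun i => (hU i).symm]
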